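/- **Setting.** Let $p$ be a prime, $\omega$ a complex primitive $p$-th root of unity, $H$ a complex space with orthonormal basis $|0\rangle,\dots,|p-1\rangle$, and let $X|i\rangle=|i+1 \bmod p\rangle$, $Z|i\rangle=\omega^i|i\rangle$. For $\vec u=(a_1,b_1,\dots,a_n,b_n)\in\mathbf Z_p^{2n}$ put $\mathsf{XZ}(\vec u)=X^{a_1}Z^{b_1}\otimes\cdots\otimes X^{a_n}Z^{b_n}$ on $H^{\otimes n}$ and $\vec u^\star=(a_1,-b_1,\dots,a_n,-b_n)$; for $\vec e=(c_1,d_1,\dots,c_n,d_n)$ let $\langle\vec u,\vec e\rangle=\sum_i (b_ic_i-a_id_i)$. Let $|\beta(a,b)\rangle=(I\otimes X^aZ^b)\,p^{-1/2}\sum_i|i\rangle\otimes|i\rangle$. Let $\alpha$ be a probability distribution on $\mathbf Z_p^2$, let $$\rho=\sum_{i,j}\alpha(i,j)\,|\beta(i,j)\rangle\langle\beta(i,j)|,$$ let $\Gamma$ be the channel on $H$ that applies $X^iZ^j$ with probability $\alpha(i,j)$, and write $\alpha(\vec u)=\prod_i\alpha(a_i,b_i)$. The fidelity of a state $\sigma$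 with a unit vector $\psi$ is $\langle\psi|\sigma|\psi\rangle$. **Codes.** An $[[n,k]]$ stabilizer code $Q$ ($1\le k\le n$) is a non-zero joint eigenspace, with eigenvalues $\lambda_1,\dots,\lambda_{n-k}$, of commuting operators $\mathsf{XZ}(\vec g_1),\dots,\mathsf{XZ}(\vec g_{n-k})$ with $\vec g_1,\dots,\vec g_{n-k}$ linearly independent over $\mathbf Z_p$. Let $C$ be the span of the $\vec g_i$. For $\vec x\in\mathbf Z_p^{n-k}$ let $Q(\vec x)$ be the joint eigenspace of the $\mathsf{XZ}(\vec g_i)$ with eigenvalues $\lambda_i\omega^{x_i}$, let $Q^\star(\vec x)$ be that of the $\mathsf{XZ}(\vec g_i^\star)$ with eigenvalues $\bar\lambda_i\omega^{-x_i}$, and let $P(\vec x)$, $P^\star(\vec x)$ be the orthogonal projections onto them. For each $\vec s\in\mathbf Z_p^{n-k}$ let $\vec e(\vec s)$ be a most likely error of syndrome $\vec s$, that is, a maximizer of $\sum_{\vec v\in\vec u+C}\alpha(\vec v)$ over the set of $\vec u$ with $\langle\vec g_i,\vec u\rangle=s_i$ for all $i$ (ties broken arbitrarily). Decoding measures $\{P(\vec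 s)\}$ and, on outcome $\vec s$, applies $\mathsf{XZ}(\vec e(\vec s))^{-1}$. The *achievable rate* of stabilizer codes over $\Gamma$ is the maximum of the real numbers $R$ such that for all $R'<R$ and $\epsilon>0$ there are an $[[n,k]]$ stabilizer code $Q$ with $1\le k\le n$, $k\ge nR'$, and a decoder of the above kind, for which every unit vector $|\varphi\rangle\in Q$ is transmitted over $\Gamma^{\otimes n}$ and decoded with fidelity at least $1-\epsilon$ (the maximum being $0$ if there is no such $R$). **Protocols.** The one-way protocol converted from $Q$ (without discarding depending on the outcomes) acts on a state shared by Alice and Bob on $H^{\otimes n}\otimes H^{\otimes n}$ as follows. Alice measures $\{P^\star(\vec a)\}$, Bob measures $\{P(\vec b)\}$, and Alice sends $\vec a$ to Bob, who applies $\mathsf{XZ}(\vec e(\vec b-\vec a))^{-1}$ with $\vec e$ a most likely error as above. Then Alice applies $\overline{U_{\vec a}}^{\,-1}$ and Bob $U_{\vec a}^{-1}$, where $U_{\vec a}$ is a unitary encoder that sends the vectors $|i\rangle\otimes|\mathrm a\rangle$ ($|i\rangle$ running over the standard basis of $H^{\otimes k}$, $|\mathrm a\rangle\in H^{\otimes(n-k)}$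 a fixed unit ancilla vector) to an orthonormal basis of $Q(\vec a)$, and both discard their last $n-k$ particles. The extracted state is the resulting state of $k$ pairs, averaged over all outcomes. The *distillable entanglement* by these protocols for $\{\rho^{\otimes n}\}$ is the maximum of the real numbers $R$ such that for all $R'<R$ and $\epsilon>0$ there is such a protocol converted from an $[[n,k]]$ stabilizer code, with $1\le k\le n$ and $k\ge nR'$, that extracts from $\rho^{\otimes n}$ a state whose fidelity with $|\beta(0,0)\rangle^{\otimes k}$ is at least $1-\epsilon$ (the maximum being $0$ if there is no such $R$). **Proposition.** Every $R$ that satisfies the condition in the definition of the achievable rate also satisfies the condition in the definition of the distillable entanglement. Consequently, the distillable entanglement by the converted one-way protocols for $\{\rho^{\otimes n}\}$ is at least as large as the achievable rate of stabilizer codes over $\Gamma$. -/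

import Mathlib

open scoped Matrix Kronecker

namespace StabDistill

noncomputable section

/-! ### Weyl (generalized Pauli) operators

The computational basis of `H` is indexed by `ZMod p`, that of `H^{⊗ n}` by `Fin n → ZMod p`.
A vector `(a_1, b_1, …, a_n, b_n)` of `Z_p^{2n}` is a map `Fin n → ZMod p × ZMod p`. -/

/-- `X |i⟩ = |i + 1⟩`. -/
def shiftX (p : ℕ) : Matrix (ZMod p) (ZMod p) ℂ :=
  Matrix.of fun r c => if r = c + 1 then 1 else 0

/-- `Z |i⟩ = ω ^ i |i⟩`. -/
def clockZ (p : ℕ) (ω : ℂ) : Matrix (ZMod p) (ZMod p) ℂ :=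
  Matrix.diagonal fun i => ω ^ i.val

/-- The one-particle operator `X ^ a Z ^ b`. -/
def weyl {p : ℕ} [Fact p.Prime] (ω : ℂ) (ab : ZMod p × ZMod p) :
    Matrix (ZMod p) (ZMod p) ℂ :=
  shiftX p ^ ab.1.val * clockZ p ω ^ ab.2.val

/-- `XZ(u) = X^{a_1} Z^{b_1} ⊗ ⋯ ⊗ X^{a_n} Z^{b_n}` on `H^{⊗ n}`. -/
def XZ {p : ℕ} [Fact p.Prime] (ω : ℂ) {n : ℕ} (u : Fin n → ZMod p × ZMod p) :
    Matrix (Fin n → ZMod p) (Fin n → ZMod p) ℂ :=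
  Matrix.of fun x y => ∏ i, weyl ω (u i) (x i) (y i)

/-- The symplectic inner product `∑ i, b_i c_i - a_i d_i`. -/
def sympl {p n : ℕ} (g e : Fin n → ZMod p × ZMod p) : ZMod p :=
  ∑ i, ((g i).2 * (e i).1 - (g i).1 * (e i).2)

/-- `(a_1, b_1, …, a_n, b_n) ↦ (a_1, -b_1, …, a_n, -b_n)`. -/
def starVec {p n : ℕ} (g : Fin n → ZMod p × ZMod p) : Fin n → ZMod p × ZMod p :=
  fun i => ((g i).1, -(g i).2)

/-! ### States, fidelity, the Pauli channel -/

/-- The operator `|v⟩⟨v|`. -/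
def pureState {ι : Type*} (v : ι → ℂ) : Matrix ι ι ℂ :=
  Matrix.vecMulVec v (star v)

/-- The fidelity `⟨v| σ |v⟩` of a state `σ` and a unit vector `v`. -/
def fidelity {ι : Type*} [Fintype ι] (v : ι → ℂ) (σ : Matrix ι ι ℂ) : ℝ :=
  (star v ⬝ᵥ (σ *ᵥ v)).re

/-- The maximally entangled vector `|β(a, b)⟩ = (I ⊗ X^a Z^b) p^{-1/2} ∑ i, |i i⟩`. -/
def bell {p : ℕ} [Fact p.Prime] (ω : ℂ) (ab : ZMod p × ZMod p) : ZMod p × ZMod p → ℂ :=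
  ((1 : Matrix (ZMod p) (ZMod p) ℂ) ⊗ₖ weyl ω ab) *ᵥ
    fun q => if q.1 = q.2 then ((1 / √(p : ℝ) : ℝ) : ℂ) else 0

/-- The vector `|β(0, 0)⟩^{⊗ k}`, as a vector of `H_A^{⊗ k} ⊗ H_B^{⊗ k}`. -/
def bellPower (p : ℕ) [Fact p.Prime] (ω : ℂ) (k : ℕ) :
    (Fin k → ZMod p) × (Fin k → ZMod p) → ℂ :=
  fun q => ∏ i, bell ω (0, 0) (q.1 i, q.2 i)

/-- The Bell-diagonal state `∑ α(i, j) |β(i, j)⟩⟨β(i, j)|` on `H_A ⊗ H_B`. -/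
def bellDiagonal {p : ℕ} [Fact p.Prime] (ω : ℂ) (α : ZMod p × ZMod p → ℝ) :
    Matrix (ZMod p × ZMod p) (ZMod p × ZMod p) ℂ :=
  ∑ ab, (α ab : ℂ) • pureState (bell ω ab)

/-- The tensor power `ρ^{⊗ n}` of a state `ρ` on `H_A ⊗ H_B`,
as a state on `H_A^{⊗ n} ⊗ H_B^{⊗ n}`. -/
def statePower {p : ℕ} (ρ : Matrix (ZMod p × ZMod p) (ZMod p × ZMod p) ℂ) (n : ℕ) :
    Matrix ((Fin n → ZMod p) × (Fin n → ZMod p)) ((Fin n → ZMod p) × (Fin n → ZMod p)) ℂ :=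
  Matrix.of fun q q' => ∏ i, ρ (q.1 i, q.2 i) (q'.1 i, q'.2 i)

/-- The probability of the error vector `u` under independent errors with law `α`. -/
def errorProb {p : ℕ} (α : ZMod p × ZMod p → ℝ) {n : ℕ} (u : Fin n → ZMod p × ZMod p) : ℝ :=
  ∏ i, α (u i)

/-- `Γ^{⊗ n}`, where the channel `Γ` on `H` applies `X^i Z^j` with probability `α(i, j)`. -/
def pauliChannel {p : ℕ} [Fact p.Prime] (ω : ℂ) (α : ZMod p × ZMod p → ℝ) {n : ℕ}
    (σ : Matrix (Fin n → ZMod p) (Fin n → ZMod p) ℂ) :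
    Matrix (Fin n → ZMod p) (Fin n → ZMod p) ℂ :=
  ∑ u, (errorProb α u : ℂ) • (XZ ω u * σ * (XZ ω u)ᴴ)

/-! ### Stabilizer codes -/

/-- The joint eigenspace of the operators `XZ(g_i)` with eigenvalues `μ_i`. -/
def jointEigenspace {p : ℕ} [Fact p.Prime] (ω : ℂ) {n m : ℕ}
    (g : Fin m → Fin n → ZMod p × ZMod p) (μ : Fin m → ℂ) :
    Submodule ℂ (EuclideanSpace ℂ (Fin n → ZMod p)) :=
  ⨅ i, Module.End.eigenspace (Matrix.toEuclideanLin (XZ ω (g i))) (μ i)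

/-- The matrix of the orthogonal projection onto a subspace. -/
def projMatrix {ι : Type*} [Fintype ι] [DecidableEq ι]
    (K : Submodule ℂ (EuclideanSpace ℂ ι)) : Matrix ι ι ℂ :=
  (Matrix.toEuclideanCLM (n := ι) (𝕜 := ℂ)).symm K.starProjection

/-- An `[[n, k]]` stabilizer code with `n = k + m`: the stabilizer is generated (up to powers
of `ω I`) by the commuting operators `XZ(g_1), …, XZ(g_m)` with `g_1, …, g_m` linearly
independent over `Z_p`, and the code is the joint eigenspace with eigenvalues
`lam 1, …, lam m`. -/
structure StabilizerCode (p : ℕ) [Fact p.Prime] (ω : ℂ) (k m : ℕ) where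
  g : Fin m → Fin (k + m) → ZMod p × ZMod p
  linearIndependent : LinearIndependent (ZMod p) g
  commute : ∀ i j, Commute (XZ ω (g i)) (XZ ω (g j))
  lam : Fin m → ℂ
  ne_bot : jointEigenspace ω g lam ≠ ⊥

namespace StabilizerCode

variable {p : ℕ} [Fact p.Prime] {ω : ℂ} {k m : ℕ}

/-- The code `Q`. -/
def code (Q : StabilizerCode p ω k m) :
    Submodule ℂ (EuclideanSpace ℂ (Fin (k + m) → ZMod p)) :=
  jointEigenspace ω Q.g Q.lam

/-- `Q(x)`: the joint eigenspace with eigenvalues `lam i * ω ^ (x i)`. -/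
def space (Q : StabilizerCode p ω k m) (x : Fin m → ZMod p) :
    Submodule ℂ (EuclideanSpace ℂ (Fin (k + m) → ZMod p)) :=
  jointEigenspace ω Q.g fun i => Q.lam i * ω ^ (x i).val

/-- `Q⋆(x)`: the joint eigenspace of the `XZ(g_i⋆)` with eigenvalues
`conj (lam i) * ω ^ (-(x i))`. -/
def spaceStar (Q : StabilizerCode p ω k m) (x : Fin m → ZMod p) :
    Submodule ℂ (EuclideanSpace ℂ (Fin (k + m) → ZMod p)) :=
  jointEigenspace ω (fun i => starVec (Q.g i))
    fun i => (starRingEnd ℂ) (Q.lam i) * (ω ^ (x i).val)⁻¹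

/-- The span `C` of `g_1, …, g_m` in `Z_p^{2n}`. -/
def classical (Q : StabilizerCode p ω k m) :
    Submodule (ZMod p) (Fin (k + m) → ZMod p × ZMod p) :=
  Submodule.span (ZMod p) (Set.range Q.g)

/-- `D(s)`: the errors with syndrome `s`. -/
def errorsOf (Q : StabilizerCode p ω k m) (s : Fin m → ZMod p) :
    Set (Fin (k + m) → ZMod p × ZMod p) :=
  {u | ∀ i, sympl (Q.g i) u = s i}

/-- The total probability of the coset `u + C`, i.e. of all the errors that act
on the code in the same way as `u`. -/
def cosetProb (Q : StabilizerCode p ω k m) (α : ZMod p × ZMod p → ℝ)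
    (u : Fin (k + m) → ZMod p × ZMod p) : ℝ :=
  ∑ v, Set.indicator {v | v - u ∈ Q.classical} (fun v => errorProb α v) v

/-- `e s` is, for each syndrome `s`, a most likely error with this syndrome,
where errors that act in the same way on the code are identified. -/
def IsMostLikely (Q : StabilizerCode p ω k m) (α : ZMod p × ZMod p → ℝ)
    (e : (Fin m → ZMod p) → Fin (k + m) → ZMod p × ZMod p) : Prop :=
  ∀ s, e s ∈ Q.errorsOf s ∧ ∀ u ∈ Q.errorsOf s, Q.cosetProb α u ≤ Q.cosetProb α (e s)

/-- Decoding: measure the syndrome `s` and apply `XZ(e(s))⁻¹`. -/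
def decode (Q : StabilizerCode p ω k m)
    (e : (Fin m → ZMod p) → Fin (k + m) → ZMod p × ZMod p)
    (σ : Matrix (Fin (k + m) → ZMod p) (Fin (k + m) → ZMod p) ℂ) :
    Matrix (Fin (k + m) → ZMod p) (Fin (k + m) → ZMod p) ℂ :=
  ∑ s, ((XZ ω (e s))⁻¹ * projMatrix (Q.space s)) * σ *
    ((XZ ω (e s))⁻¹ * projMatrix (Q.space s))ᴴ

end StabilizerCode

/-- There is a `[[k + m, k]]` stabilizer code such that, with the most likely error decoding,
every state of the code is transmitted over `Γ^{⊗ (k + m)}` with fidelity at least `1 - ε`. -/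
def CodeExists (p : ℕ) [Fact p.Prime] (ω : ℂ) (α : ZMod p × ZMod p → ℝ)
    (k m : ℕ) (ε : ℝ) : Prop :=
  ∃ (Q : StabilizerCode p ω k m) (e : (Fin m → ZMod p) → Fin (k + m) → ZMod p × ZMod p),
    Q.IsMostLikely α e ∧
    ∀ φ ∈ Q.code, ‖φ‖ = 1 →
      1 - ε ≤ fidelity φ.ofLp (Q.decode e (pauliChannel ω α (pureState φ.ofLp)))

/-! ### The converted one-way protocols -/

/-- The vector `|i⟩ ⊗ |anc⟩` of `H^{⊗ (k + m)}`, for a basis vector `|i⟩` of `H^{⊗ k}`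
and a vector `|anc⟩` of `H^{⊗ m}`. -/
def ketTensor {p k m : ℕ} (i : Fin k → ZMod p) (anc : (Fin m → ZMod p) → ℂ) :
    (Fin (k + m) → ZMod p) → ℂ :=
  fun x => if (fun j => x (Fin.castAdd m j)) = i then anc (fun j => x (Fin.natAdd k j)) else 0

/-- The partial trace over the last `m` particles of Alice and the last `m` particles of Bob. -/
def discardLast {p : ℕ} [Fact p.Prime] {k m : ℕ}
    (τ : Matrix ((Fin (k + m) → ZMod p) × (Fin (k + m) → ZMod p))
      ((Fin (k + m) → ZMod p) × (Fin (k + m) → ZMod p)) ℂ) :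
    Matrix ((Fin k → ZMod p) × (Fin k → ZMod p)) ((Fin k → ZMod p) × (Fin k → ZMod p)) ℂ :=
  Matrix.of fun q q' => ∑ z : Fin m → ZMod p, ∑ w : Fin m → ZMod p,
    τ (Fin.append q.1 z, Fin.append q.2 w) (Fin.append q'.1 z, Fin.append q'.2 w)

/-- The data of a one-way protocol converted from a `[[k + m, k]]` stabilizer code:
the code, the guessed errors, the ancilla state, and an encoding operator `enc a` for each
of the codes `Q(a)`, that is, a unitary operator such that the vectors
`enc a (|i⟩ ⊗ |anc⟩)` form an (orthonormal) basis of `Q(a)`. -/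
structure Protocol (p : ℕ) [Fact p.Prime] (ω : ℂ) (α : ZMod p × ZMod p → ℝ) (k m : ℕ) where
  Q : StabilizerCode p ω k m
  e : (Fin m → ZMod p) → Fin (k + m) → ZMod p × ZMod p
  mostLikely : Q.IsMostLikely α e
  anc : EuclideanSpace ℂ (Fin m → ZMod p)
  norm_anc : ‖anc‖ = 1
  enc : (Fin m → ZMod p) → Matrix (Fin (k + m) → ZMod p) (Fin (k + m) → ZMod p) ℂ
  enc_unitary : ∀ a, enc a ∈ Matrix.unitaryGroup (Fin (k + m) → ZMod p) ℂ
  enc_span : ∀ a, Submodule.span ℂ (Set.range fun i : Fin k → ZMod p =>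
    WithLp.toLp 2 (enc a *ᵥ ketTensor i anc.ofLp)) = Q.space a

namespace Protocol

variable {p : ℕ} [Fact p.Prime] {ω : ℂ} {α : ZMod p × ZMod p → ℝ} {k m : ℕ}

/-- The operator applied when the measurement outcomes are `a` (Alice) and `b` (Bob):
first the projections `P⋆(a) ⊗ P(b)` of the two measurements, then Bob's correction
`XZ(e(b - a))⁻¹`, then the inverse of the encoding operators (Alice uses the complex
conjugate of Bob's one). -/
def kraus (P : Protocol p ω α k m) (a b : Fin m → ZMod p) :
    Matrix ((Fin (k + m) → ZMod p) × (Fin (k + m) → ZMod p))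
      ((Fin (k + m) → ZMod p) × (Fin (k + m) → ZMod p)) ℂ :=
  (((P.enc a).map (starRingEnd ℂ))⁻¹ ⊗ₖ (P.enc a)⁻¹) *
    (1 ⊗ₖ (XZ ω (P.e (b - a)))⁻¹) *
    (projMatrix (P.Q.spaceStar a) ⊗ₖ projMatrix (P.Q.space b))

/-- The state extracted from `ρ`, averaged over all the measurement outcomes
(nothing is discarded depending on the outcomes). -/
def output (P : Protocol p ω α k m)
    (ρ : Matrix ((Fin (k + m) → ZMod p) × (Fin (k + m) → ZMod p))
      ((Fin (k + m) → ZMod p) × (Fin (k + m) → ZMod p)) ℂ) :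
    Matrix ((Fin k → ZMod p) × (Fin k → ZMod p)) ((Fin k → ZMod p) × (Fin k → ZMod p)) ℂ :=
  discardLast (∑ a, ∑ b, P.kraus a b * ρ * (P.kraus a b)ᴴ)

end Protocol

/-- There is a converted one-way protocol that extracts from `ρ^{⊗ (k + m)}`, `ρ` the
Bell-diagonal state with weights `α`, a state of `k` pairs of particles whose fidelity with
`|β(0, 0)⟩^{⊗ k}` is at least `1 - ε`. -/
def ProtocolExists (p : ℕ) [Fact p.Prime] (ω : ℂ) (α : ZMod p × ZMod p → ℝ)
    (k m : ℕ) (ε : ℝ) : Prop :=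
  ∃ P : Protocol p ω α k m,
    1 - ε ≤ fidelity (bellPower p ω k) (P.output (statePower (bellDiagonal ω α) (k + m)))

/-! ### Rates -/

/-- For each `R' < R` and each `ε > 0` there are `n = k + m` and `k` with `1 ≤ k ≤ n`
and `k ≥ n R'` for which `T k m ε` holds. -/
def IsRate (T : ℕ → ℕ → ℝ → Prop) (R : ℝ) : Prop :=
  ∀ R' < R, ∀ ε > 0, ∃ k m : ℕ, 1 ≤ k ∧ ((k + m : ℕ) : ℝ) * R' ≤ k ∧ T k m ε

/-- The maximal `R` with `IsRate T R` (and `0` if there is none). -/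
def maxRate (T : ℕ → ℕ → ℝ → Prop) : ℝ := sSup {R | IsRate T R}

theorem isGreatest_maxRate (T : ℕ → ℕ → ℝ → Prop) (h : {R | IsRate T R}.Nonempty) :
    IsGreatest {R | IsRate T R} (maxRate T) := by
  have hb : BddAbove {R | IsRate T R} := by
    refine ⟨1, fun R hR => ?_⟩
    by_contra hlt
    push Not at hlt
    obtain ⟨k, m, hk, hkm, -⟩ := hR ((1 + R) / 2) (by linarith) 1 one_pos
    have hk' : (1 : ℝ) ≤ k := by exact_mod_cast hk
    have hm : (0 : ℝ) ≤ m := Nat.cast_nonneg m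
    push_cast at hkm
    nlinarith
  refine ⟨fun R' hR' ε hε => ?_, fun R hR => le_csSup hb hR⟩
  obtain ⟨R, hR, hlt⟩ := exists_lt_of_lt_csSup h hR'
  exact hR R' hlt ε hε

/-- The achievable rate of stabilizer codes over the channel `Γ` given by `α`. -/
def achievableRate (p : ℕ) [Fact p.Prime] (ω : ℂ) (α : ZMod p × ZMod p → ℝ) : ℝ :=
  maxRate (CodeExists p ω α)

/-- The entanglement distillable by the converted one-way protocols from the states
`ρ^{⊗ n}`, `ρ` the Bell-diagonal state with weights `α`. -/
def distillableEntanglement (p : ℕ) [Fact p.Prime] (ω : ℂ) (α : ZMod p × ZMod p → ℝ) : ℝ :=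
  maxRate (ProtocolExists p ω α)

end

end StabDistill

/-! The link between codes and protocols is entanglement fidelity. Write the state shared by Alice
and Bob as a mixture, with the channel's own weights `errorProb α u`, of the vectorized operators
`XZ ω u` (`statePower_bellDiagonal`). A product operator acts on a vectorized matrix by
multiplication on both sides, so Alice's projection, transposed, becomes a projection fixing
`Q.space a`. Alice's outcome `a` thus plays the role of preparing half of a maximally entangled
state of that space. The error `u` moves it to `Q.space (a + Q.syndrome u)`, Bob's outcome reveals
the syndrome as `b - a`, and his correction leaves the same residual operator as the decoder of the
code.

With encoders `XZ ω (e a) * U`, changing `a` alters this residual operator only by a phase. The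
extracted fidelity is therefore at least the mean of the squared normalized trace of the residual
operator on the code (`exists_protocol`), while the decoding fidelity of a code vector is the mean
of its squared diagonal matrix element (`fidelity_decode`).

It remains to pass from all pure states of the code to the maximally entangled one, with a loss
independent of the dimension: `entanglement_fidelity_bound` does so by testing superpositions of two
basis vectors, and turns `ε` into `4 * ε`. As `ε` is arbitrary and `k`, `m` do not change, rates are
preserved. -/

namespace StabDistill

/-! ### From pure-state fidelity to entanglement fidelity -/

section AverageFidelity

variable {E : Type*} [NormedAddCommGroup E] [InnerProductSpace ℂ E]

theorem norm_sq_add_norm_sq_inner_le {φ ψ v : E} (hφ : ‖φ‖ = 1) (hψ : ‖ψ‖ = 1)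
    (h : inner ℂ φ ψ = 0) : ‖inner ℂ φ v‖ ^ 2 + ‖inner ℂ ψ v‖ ^ 2 ≤ ‖v‖ ^ 2 := by
  have ho : Orthonormal ℂ ![φ, ψ] := by
    rw [orthonormal_iff_ite]
    intro i j
    fin_cases i <;> fin_cases j <;>
      simp [h, hφ, hψ, inner_eq_zero_symm.mp h, inner_self_eq_norm_sq_to_K]
  simpa using ho.sum_inner_products_le (s := Finset.univ) v

/-- The two diagonal elements are half the sum and half the difference of the same two numbers, so
this is the parallelogram law in `ℂ`. Adding both signs removes the cross terms between diagonal and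
off-diagonal elements. -/
theorem norm_inner_superposition (W : E →ₗ[ℂ] E) (φ ψ : E) :
    ‖inner ℂ ((1 / √2 : ℝ) • (φ + ψ)) (W ((1 / √2 : ℝ) • (φ + ψ)))‖ ^ 2 +
      ‖inner ℂ ((1 / √2 : ℝ) • (φ - ψ)) (W ((1 / √2 : ℝ) • (φ - ψ)))‖ ^ 2 =
    (‖inner ℂ φ (W φ) + inner ℂ ψ (W ψ)‖ ^ 2 +
      ‖inner ℂ φ (W ψ) + inner ℂ ψ (W φ)‖ ^ 2) / 2 := by
  have h2 : (1 / √2 : ℝ) * (1 / √2) = 1 / 2 := by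
    rw [div_mul_div_comm, Real.mul_self_sqrt (by norm_num)]; norm_num
  have hs : ∀ v : E, inner ℂ ((1 / √2 : ℝ) • v) (W ((1 / √2 : ℝ) • v)) =
      ((1 / 2 : ℝ) : ℂ) * inner ℂ v (W v) := by
    intro v
    rw [← h2, ← Complex.coe_smul, map_smul, inner_smul_left, inner_smul_right]
    push_cast
    simp
    ring
  have hp := parallelogram_law_with_norm ℝ (inner ℂ φ (W φ) + inner ℂ ψ (W ψ))
    (inner ℂ φ (W ψ) + inner ℂ ψ (W φ))
  rw [hs, hs, norm_mul, norm_mul, Complex.norm_real]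
  have e1 : inner ℂ (φ + ψ) (W (φ + ψ)) = (inner ℂ φ (W φ) + inner ℂ ψ (W ψ)) +
    (inner ℂ φ (W ψ) + inner ℂ ψ (W φ)) := by
    simp only [map_add, inner_add_left, inner_add_right]; ring
  have e2 : inner ℂ (φ - ψ) (W (φ - ψ)) = (inner ℂ φ (W φ) + inner ℂ ψ (W ψ)) -
    (inner ℂ φ (W ψ) + inner ℂ ψ (W φ)) := by
    simp only [map_sub, inner_sub_left, inner_sub_right]; ring
  rw [e1, e2]
  norm_num
  linarith

/-- A random isometry that preserves all unit vectors of a subspace with fidelity `1 - ε`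
preserves the maximally entangled state with fidelity `1 - 4 ε`. -/
theorem entanglement_fidelity_bound {κ ι : Type*} [Fintype κ] [Fintype ι]
    {w : κ → ℝ} (hw : ∀ u, 0 ≤ w u) (hw1 : ∑ u, w u = 1)
    (W : κ → E →ₗ[ℂ] E) (hW : ∀ u v, ‖W u v‖ = ‖v‖) (S : Submodule ℂ E) {φ : ι → E}
    (hφ : Orthonormal ℂ φ) (hφS : ∀ i, φ i ∈ S) {ε : ℝ} (hε : 0 ≤ ε)
    (h : ∀ v ∈ S, ‖v‖ = 1 → 1 - ε ≤ ∑ u, w u * ‖inner ℂ v (W u v)‖ ^ 2) :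
    (1 - 4 * ε) * (Fintype.card ι : ℝ) ^ 2 ≤
      ∑ u, w u * ‖∑ i, inner ℂ (φ i) (W u (φ i))‖ ^ 2 := by
  classical
  set c : κ → ι → ι → ℂ := fun u i j => inner ℂ (φ i) (W u (φ j)) with hc
  have hdiag : ∀ i, 1 - ε ≤ ∑ u, w u * ‖c u i i‖ ^ 2 := fun i => h _ (hφS i) (hφ.1 i)
  -- Bessel's inequality for the unit vector `W u (φ j)`: large diagonal elements force small
  -- off-diagonal ones.
  have hcol : ∀ u i j, i ≠ j → ‖c u i j‖ ^ 2 + ‖c u j j‖ ^ 2 ≤ 1 := fun u i j hij => by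
    have := norm_sq_add_norm_sq_inner_le (v := W u (φ j)) (hφ.1 i) (hφ.1 j) (hφ.2 hij)
    rwa [hW, hφ.1, one_pow] at this
  -- The squared modulus of the trace is the sum of these real parts over all pairs, so a bound for
  -- each pair suffices, and no dimension factor enters the error.
  have hpair : ∀ i j, 1 - 4 * ε ≤ ∑ u, w u * (c u i i * (starRingEnd ℂ) (c u j j)).re := by
    intro i j
    by_cases hij : i = j
    · subst hij
      refine le_trans (by linarith) (hdiag i) |>.trans (le_of_eq ?_)
      refine Finset.sum_congr rfl fun u _ => ?_
      rw [Complex.mul_conj, Complex.normSq_eq_norm_sq, Complex.ofReal_re]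
    · have horth : inner ℂ (φ i) (φ j) = 0 := hφ.2 hij
      have hn : ∀ v : E, ‖v‖ ^ 2 = 2 → ‖(1 / √2 : ℝ) • v‖ = 1 := by
        intro v hv
        have : ‖v‖ = √2 := by rw [← hv, Real.sqrt_sq (norm_nonneg _)]
        rw [norm_smul, this, Real.norm_of_nonneg (by positivity)]
        field_simp
      have hp := h ((1 / √2 : ℝ) • (φ i + φ j))
        (by rw [← Complex.coe_smul]; exact S.smul_mem _ (S.add_mem (hφS i) (hφS j)))
        (hn _ (by rw [@norm_add_sq ℂ, horth, hφ.1, hφ.1]; norm_num))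
      have hm := h ((1 / √2 : ℝ) • (φ i - φ j))
        (by rw [← Complex.coe_smul]; exact S.smul_mem _ (S.sub_mem (hφS i) (hφS j)))
        (hn _ (by rw [@norm_sub_sq ℂ, horth, hφ.1, hφ.1]; norm_num))
      have hkey : ∀ u, w u * ‖inner ℂ ((1 / √2 : ℝ) • (φ i + φ j))
            (W u ((1 / √2 : ℝ) • (φ i + φ j)))‖ ^ 2 +
          w u * ‖inner ℂ ((1 / √2 : ℝ) • (φ i - φ j))
            (W u ((1 / √2 : ℝ) • (φ i - φ j)))‖ ^ 2 ≤
          w u * (c u i i * (starRingEnd ℂ) (c u j j)).re + 2 * w u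
            - (w u * ‖c u i i‖ ^ 2) / 2 - (w u * ‖c u j j‖ ^ 2) / 2 := by
        intro u
        rw [← mul_add, norm_inner_superposition]
        have h1 : ‖c u i i + c u j j‖ ^ 2 = ‖c u i i‖ ^ 2 + ‖c u j j‖ ^ 2 +
            2 * (c u i i * (starRingEnd ℂ) (c u j j)).re := by
          rw [Complex.sq_norm, Complex.normSq_add, Complex.sq_norm, Complex.sq_norm]
        have h2 : ‖c u i j + c u j i‖ ^ 2 ≤ 2 * (‖c u i j‖ ^ 2 + ‖c u j i‖ ^ 2) := by
          have := norm_add_le (c u i j) (c u j i)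
          nlinarith [norm_nonneg (c u i j + c u j i), sq_nonneg (‖c u i j‖ - ‖c u j i‖)]
        have h3 := hcol u i j hij
        have h4 := hcol u j i (Ne.symm hij)
        have : (‖c u i i + c u j j‖ ^ 2 + ‖c u i j + c u j i‖ ^ 2) / 2 ≤
            (c u i i * (starRingEnd ℂ) (c u j j)).re + 2
              - ‖c u i i‖ ^ 2 / 2 - ‖c u j j‖ ^ 2 / 2 := by linarith
        have := mul_le_mul_of_nonneg_left this (hw u)
        refine this.trans (le_of_eq (by ring))
      have hsum := Finset.sum_le_sum fun u (_ : u ∈ Finset.univ) => hkey u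
      rw [Finset.sum_add_distrib, Finset.sum_sub_distrib, Finset.sum_sub_distrib,
        Finset.sum_add_distrib, ← Finset.mul_sum, hw1, ← Finset.sum_div, ← Finset.sum_div]
        at hsum
      -- The two superpositions together contribute `2 - 2 * ε` and the diagonal terms `1 - ε`,
      -- which gives `1 - 3 * ε`; the constant 4 is not sharp.
      have h5 := hdiag i
      have h6 := hdiag j
      linarith
  have hexp : ∀ u, ‖∑ i, c u i i‖ ^ 2 =
      ∑ i, ∑ j, (c u i i * (starRingEnd ℂ) (c u j j)).re := by
    intro u
    rw [← Complex.normSq_eq_norm_sq, ← Complex.ofReal_re (Complex.normSq _), ← Complex.mul_conj,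
      map_sum, Finset.sum_mul_sum, Complex.re_sum]
    simp only [Complex.re_sum]
  calc (1 - 4 * ε) * (Fintype.card ι : ℝ) ^ 2 = ∑ _i : ι, ∑ _j : ι, (1 - 4 * ε) := by
        simp; ring
    _ ≤ ∑ i, ∑ j, ∑ u, w u * (c u i i * (starRingEnd ℂ) (c u j j)).re :=
        Finset.sum_le_sum fun i _ => Finset.sum_le_sum fun j _ => hpair i j
    _ = ∑ u, w u * ‖∑ i, c u i i‖ ^ 2 := by
        simp only [hexp, Finset.mul_sum]
        rw [Finset.sum_comm (s := Finset.univ (α := κ))]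
        refine Finset.sum_congr rfl fun i _ => ?_
        rw [Finset.sum_comm]

end AverageFidelity

/-! ### Weyl operators: commutation, unitarity, complex conjugation -/

section Weyl

variable {p : ℕ} [Fact p.Prime] {ω : ℂ} {n : ℕ}

/-- The character `z ↦ ω ^ z` of `ZMod p`. -/
noncomputable def chr (ω : ℂ) (z : ZMod p) : ℂ := ω ^ z.val

theorem chr_zero : chr ω (0 : ZMod p) = 1 := by simp [chr]

theorem chr_add (hω : IsPrimitiveRoot ω p) (a b : ZMod p) : chr ω (a + b) = chr ω a * chr ω b := by
  rw [chr, chr, chr, ← pow_add, ZMod.val_add, ← pow_eq_pow_mod _ hω.pow_eq_one]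

theorem chr_mul (hω : IsPrimitiveRoot ω p) (a b : ZMod p) : chr ω (a * b) = ω ^ (b.val * a.val) := by
  rw [chr, ZMod.val_mul, ← pow_eq_pow_mod _ hω.pow_eq_one, mul_comm]

theorem chr_sum (hω : IsPrimitiveRoot ω p) {ι : Type*} (s : Finset ι) (f : ι → ZMod p) :
    chr ω (∑ i ∈ s, f i) = ∏ i ∈ s, chr ω (f i) := by
  classical
  induction s using Finset.induction_on with
  | empty => simp [chr_zero]
  | insert a s ha ih => rw [Finset.sum_insert ha, Finset.prod_insert ha, chr_add hω, ih]

theorem norm_chr (hω : IsPrimitiveRoot ω p) (a : ZMod p) : ‖chr ω a‖ = 1 := by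
  rw [chr, norm_pow, hω.norm'_eq_one (Fact.out : p.Prime).ne_zero, one_pow]

theorem chr_injective (hω : IsPrimitiveRoot ω p) : Function.Injective (chr ω : ZMod p → ℂ) :=
  fun a b h => ZMod.val_injective p (hω.pow_inj a.val_lt b.val_lt h)

theorem chr_neg (hω : IsPrimitiveRoot ω p) (a : ZMod p) :
    chr ω (-a) = (starRingEnd ℂ) (chr ω a) := by
  have h : chr ω (-a) * chr ω a = 1 := by rw [← chr_add hω, neg_add_cancel, chr_zero]
  rw [eq_comm, ← Complex.inv_eq_conj (norm_chr hω a)]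
  exact (eq_inv_of_mul_eq_one_left h).symm

theorem chr_surjOn (hω : IsPrimitiveRoot ω p) {z : ℂ} (hz : z ^ p = 1) :
    ∃ a : ZMod p, chr ω a = z := by
  have : NeZero p := ⟨(Fact.out : p.Prime).ne_zero⟩
  obtain ⟨i, hi, rfl⟩ := hω.eq_pow_of_pow_eq_one hz
  exact ⟨i, by rw [chr, ZMod.val_natCast_of_lt hi]⟩

theorem shiftX_pow_apply (a : ℕ) (x y : ZMod p) :
    (shiftX p ^ a) x y = if x = y + a then 1 else 0 := by
  induction a generalizing x y with
  | zero => simp [Matrix.one_apply]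
  | succ a ih =>
    rw [pow_succ, Matrix.mul_apply]
    simp only [ih]
    rw [Finset.sum_eq_single (y + 1)]
    · simp [shiftX, add_comm, add_left_comm]
    · intro z _ hz
      simp [shiftX, hz]
    · simp

theorem weyl_apply (hω : IsPrimitiveRoot ω p) (ab : ZMod p × ZMod p) (x y : ZMod p) :
    weyl ω ab x y = if x = y + ab.1 then chr ω (ab.2 * y) else 0 := by
  rw [weyl, clockZ, Matrix.diagonal_pow, Matrix.mul_diagonal, shiftX_pow_apply, chr_mul hω]
  simp [pow_mul]

theorem XZ_apply (hω : IsPrimitiveRoot ω p) (u : Fin n → ZMod p × ZMod p) (x y : Fin n → ZMod p) :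
    XZ ω u x y = if x = y + (fun i => (u i).1) then chr ω ((fun i => (u i).2) ⬝ᵥ y) else 0 := by
  simp only [XZ, Matrix.of_apply, weyl_apply hω, dotProduct, chr_sum hω, funext_iff, Pi.add_apply]
  split_ifs with h
  · exact Finset.prod_congr rfl fun i _ => if_pos (h i)
  · push Not at h
    obtain ⟨i, hi⟩ := h
    exact Finset.prod_eq_zero (Finset.mem_univ i) (if_neg hi)

theorem XZ_zero (hω : IsPrimitiveRoot ω p) : XZ ω (0 : Fin n → ZMod p × ZMod p) = 1 := by
  ext x y
  rw [XZ_apply hω, Matrix.one_apply]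
  have : (fun i => ((0 : Fin n → ZMod p × ZMod p) i).1) = 0 := rfl
  have h' : (fun i => ((0 : Fin n → ZMod p × ZMod p) i).2) = 0 := rfl
  rw [this, h', add_zero, zero_dotProduct, chr_zero]

theorem XZ_mul (hω : IsPrimitiveRoot ω p) (u v : Fin n → ZMod p × ZMod p) :
    XZ ω u * XZ ω v = chr ω (∑ i, (u i).2 * (v i).1) • XZ ω (u + v) := by
  ext x y
  rw [Matrix.mul_apply, Matrix.smul_apply, XZ_apply hω (u + v)]
  simp only [XZ_apply hω u, XZ_apply hω v]
  rw [Finset.sum_eq_single (y + fun i => (v i).1)]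
  · rw [if_pos rfl, ite_mul, zero_mul, smul_eq_mul, mul_ite, mul_zero]
    refine if_congr ?_ ?_ rfl
    · rw [add_assoc, show ((fun i => (v i).1) + fun i => (u i).1) = fun i => ((u + v) i).1 from
        funext fun i => add_comm _ _]
    · rw [← chr_add hω, ← chr_add hω]
      congr 1
      simp only [dotProduct, ← Finset.sum_add_distrib]
      refine Finset.sum_congr rfl fun i _ => ?_
      simp only [Pi.add_apply, Prod.snd_add]
      ring
  · intro z _ hz
    rw [if_neg hz, mul_zero]
  · simp

theorem XZ_commutation (hω : IsPrimitiveRoot ω p) (u v : Fin n → ZMod p × ZMod p) :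
    XZ ω u * XZ ω v = chr ω (sympl u v) • (XZ ω v * XZ ω u) := by
  rw [XZ_mul hω, XZ_mul hω, smul_smul, ← chr_add hω, add_comm v u]
  congr 2
  rw [sympl, ← Finset.sum_add_distrib]
  exact Finset.sum_congr rfl fun i _ => by ring

theorem XZ_conjTranspose_mul (hω : IsPrimitiveRoot ω p) (u : Fin n → ZMod p × ZMod p) :
    (XZ ω u)ᴴ * XZ ω u = 1 := by
  ext x y
  rw [Matrix.mul_apply]
  simp only [Matrix.conjTranspose_apply, XZ_apply hω u]
  rw [Finset.sum_eq_single (y + fun i => (u i).1), Matrix.one_apply]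
  · rw [if_pos rfl]
    by_cases h : x = y
    · subst h
      rw [if_pos rfl, if_pos rfl, Complex.star_def, Complex.conj_mul', norm_chr hω]
      norm_num
    · rw [if_neg h, if_neg (fun h' => h (add_right_cancel h').symm), star_zero, zero_mul]
  · intro z _ hz
    rw [if_neg hz, mul_zero]
  · simp

theorem XZ_mul_conjTranspose (hω : IsPrimitiveRoot ω p) (u : Fin n → ZMod p × ZMod p) :
    XZ ω u * (XZ ω u)ᴴ = 1 := mul_eq_one_comm.mp (XZ_conjTranspose_mul hω u)

theorem XZ_inv (hω : IsPrimitiveRoot ω p) (u : Fin n → ZMod p × ZMod p) :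
    (XZ ω u)⁻¹ = (XZ ω u)ᴴ := Matrix.inv_eq_left_inv (XZ_conjTranspose_mul hω u)

theorem XZ_pow (hω : IsPrimitiveRoot ω p) (u : Fin n → ZMod p × ZMod p) (j : ℕ) :
    ∃ c : ℂ, XZ ω u ^ j = c • XZ ω (j • u) := by
  induction j with
  | zero => exact ⟨1, by rw [pow_zero, zero_smul, XZ_zero hω, one_smul]⟩
  | succ j ih =>
    obtain ⟨c, hc⟩ := ih
    exact ⟨c * _, by rw [pow_succ, hc, Matrix.smul_mul, XZ_mul hω, smul_smul, succ_nsmul]⟩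

/-- Powers of a Weyl operator follow the multiples of its index up to scalars, and `p • u = 0`. -/
theorem XZ_pow_prime (hω : IsPrimitiveRoot ω p) (u : Fin n → ZMod p × ZMod p) :
    ∃ c : ℂ, XZ ω u ^ p = c • 1 := by
  obtain ⟨c, hc⟩ := XZ_pow hω u p
  refine ⟨c, ?_⟩
  rw [hc, ← XZ_zero hω]
  congr 2
  ext i <;> simp

theorem XZ_starVec (hω : IsPrimitiveRoot ω p) (u : Fin n → ZMod p × ZMod p) :
    XZ ω (starVec u) = (XZ ω u).map (starRingEnd ℂ) := by
  ext x y
  rw [Matrix.map_apply, XZ_apply hω, XZ_apply hω, apply_ite (starRingEnd ℂ), map_zero,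
    ← chr_neg hω, ← neg_dotProduct]
  rfl

end Weyl

/-! ### Matrices of orthogonal projections -/

section Projections

variable {ι : Type*} [Fintype ι] [DecidableEq ι]

theorem projMatrix_mulVec (K : Submodule ℂ (EuclideanSpace ℂ ι)) (v : EuclideanSpace ℂ ι) :
    projMatrix K *ᵥ v.ofLp = (K.starProjection v).ofLp := by
  rw [projMatrix, ← Matrix.ofLp_toEuclideanCLM, StarAlgEquiv.apply_symm_apply]

theorem projMatrix_mulVec_of_mem {K : Submodule ℂ (EuclideanSpace ℂ ι)} {v : EuclideanSpace ℂ ι}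
    (hv : v ∈ K) : projMatrix K *ᵥ v.ofLp = v.ofLp := by
  rw [projMatrix_mulVec, Submodule.starProjection_eq_self_iff.mpr hv]

theorem projMatrix_mulVec_of_mem_orthogonal {K : Submodule ℂ (EuclideanSpace ℂ ι)}
    {v : EuclideanSpace ℂ ι} (hv : v ∈ Kᗮ) : projMatrix K *ᵥ v.ofLp = 0 := by
  rw [projMatrix_mulVec, K.starProjection_apply_eq_zero_iff.mpr hv]
  rfl

theorem projMatrix_isHermitian (K : Submodule ℂ (EuclideanSpace ℂ ι)) :
    (projMatrix K).IsHermitian := by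
  have h := (Matrix.toEuclideanCLM (n := ι) (𝕜 := ℂ)).symm.map_star' K.starProjection
  rw [(isSelfAdjoint_starProjection K).star_eq] at h
  exact h.symm

end Projections

/-! ### The decomposition of the space into syndrome eigenspaces -/

section Eigenspaces

variable {p : ℕ} [Fact p.Prime] {ω : ℂ} {n m k : ℕ}

theorem mem_jointEigenspace {g : Fin m → Fin n → ZMod p × ZMod p} {μ : Fin m → ℂ}
    {v : EuclideanSpace ℂ (Fin n → ZMod p)} :
    v ∈ jointEigenspace ω g μ ↔ ∀ i, XZ ω (g i) *ᵥ v.ofLp = μ i • v.ofLp := by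
  simp only [jointEigenspace, Submodule.mem_iInf, Module.End.mem_eigenspace_iff]
  refine forall_congr' fun i => ?_
  rw [← (WithLp.ofLp_injective 2).eq_iff]
  rfl

/-- The action of `XZ(u)` on `H^{⊗ n}` as a linear map. -/
noncomputable def XZLin (ω : ℂ) (u : Fin n → ZMod p × ZMod p) :
    EuclideanSpace ℂ (Fin n → ZMod p) →ₗ[ℂ] EuclideanSpace ℂ (Fin n → ZMod p) :=
  Matrix.toEuclideanLin (XZ ω u)

theorem ofLp_XZLin (u : Fin n → ZMod p × ZMod p) (v : EuclideanSpace ℂ (Fin n → ZMod p)) :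
    (XZLin ω u v).ofLp = XZ ω u *ᵥ v.ofLp := rfl

theorem inner_eq_dotProduct_star {ι : Type*} [Fintype ι] (v w : EuclideanSpace ℂ ι) :
    inner ℂ v w = star v.ofLp ⬝ᵥ w.ofLp := by
  rw [EuclideanSpace.inner_eq_star_dotProduct, dotProduct_comm]

theorem inner_XZLin (hω : IsPrimitiveRoot ω p) (u : Fin n → ZMod p × ZMod p)
    (v w : EuclideanSpace ℂ (Fin n → ZMod p)) :
    inner ℂ (XZLin ω u v) (XZLin ω u w) = inner ℂ v w := by
  rw [inner_eq_dotProduct_star, inner_eq_dotProduct_star, ofLp_XZLin, ofLp_XZLin,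
    Matrix.star_mulVec, Matrix.dotProduct_mulVec, Matrix.vecMul_vecMul,
    XZ_conjTranspose_mul hω, Matrix.vecMul_one]

theorem norm_XZLin (hω : IsPrimitiveRoot ω p) (u : Fin n → ZMod p × ZMod p)
    (v : EuclideanSpace ℂ (Fin n → ZMod p)) : ‖XZLin ω u v‖ = ‖v‖ := by
  rw [@norm_eq_sqrt_re_inner ℂ, inner_XZLin hω, ← @norm_eq_sqrt_re_inner ℂ]

theorem XZLin_injective (hω : IsPrimitiveRoot ω p) (u : Fin n → ZMod p × ZMod p) :
    Function.Injective (XZLin ω u) := by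
  rw [← LinearMap.ker_eq_bot, LinearMap.ker_eq_bot']
  intro v hv
  rw [← norm_eq_zero, ← norm_XZLin hω u, hv, norm_zero]

theorem norm_eigenvalue (hω : IsPrimitiveRoot ω p) {u : Fin n → ZMod p × ZMod p} {c : ℂ}
    {v : EuclideanSpace ℂ (Fin n → ZMod p)} (hv : v ≠ 0) (h : XZLin ω u v = c • v) : ‖c‖ = 1 := by
  have := norm_XZLin hω u v
  rw [h, norm_smul] at this
  exact (mul_eq_right₀ (norm_ne_zero_iff.mpr hv)).mp this

theorem inner_eq_zero_of_eigenvalue_ne (hω : IsPrimitiveRoot ω p) {u : Fin n → ZMod p × ZMod p}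
    {c d : ℂ} (hcd : c ≠ d) {v w : EuclideanSpace ℂ (Fin n → ZMod p)}
    (hv : XZLin ω u v = c • v) (hw : XZLin ω u w = d • w) : inner ℂ v w = 0 := by
  by_cases hv0 : v = 0
  · rw [hv0, inner_zero_left]
  have hc := norm_eigenvalue hω hv0 hv
  have := inner_XZLin hω u v w
  rw [hv, hw, inner_smul_left, inner_smul_right, ← Complex.inv_eq_conj hc, ← mul_assoc] at this
  by_contra hne
  have h1 := (mul_eq_right₀ hne).mp this
  have hc0 : c ≠ 0 := by rw [← norm_ne_zero_iff, hc]; exact one_ne_zero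
  exact hcd ((inv_mul_eq_one₀ hc0).mp h1)

/-- The `p`-th power is a scalar by `XZ_pow_prime`, and any single eigenvector determines which one.
Hence any two eigenvalues differ by a `p`-th root of unity. -/
theorem eigenvalue_pow_prime (hω : IsPrimitiveRoot ω p) {u : Fin n → ZMod p × ZMod p} {c : ℂ}
    {v : EuclideanSpace ℂ (Fin n → ZMod p)} (hv : v ≠ 0) (h : XZLin ω u v = c • v) :
    XZLin ω u ^ p = c ^ p • (1 : Module.End ℂ (EuclideanSpace ℂ (Fin n → ZMod p))) := by
  obtain ⟨d, hd⟩ := XZ_pow_prime hω u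
  have hp : ∀ j : ℕ, (XZLin ω u ^ j) v = c ^ j • v := by
    intro j
    induction j with
    | zero => simp
    | succ j ih => rw [pow_succ, Module.End.mul_apply, h, map_smul, ih, smul_smul, ← pow_succ']
  have hm : ∀ (j : ℕ) (w : EuclideanSpace ℂ (Fin n → ZMod p)),
      ((XZLin ω u ^ j) w).ofLp = (XZ ω u ^ j) *ᵥ w.ofLp := by
    intro j
    induction j with
    | zero => simp
    | succ j ih =>
      intro w
      rw [pow_succ, Module.End.mul_apply, ih, ofLp_XZLin, Matrix.mulVec_mulVec, ← pow_succ]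
  have hd' : XZLin ω u ^ p = d • (1 : Module.End ℂ (EuclideanSpace ℂ (Fin n → ZMod p))) := by
    ext1 w
    apply WithLp.ofLp_injective 2
    rw [hm, hd]
    simp [Matrix.smul_mulVec]
  have hcd := hp p
  rw [hd', LinearMap.smul_apply, Module.End.one_apply] at hcd
  rw [hd', smul_left_injective ℂ hv hcd]

namespace StabilizerCode

theorem mem_space {Q : StabilizerCode p ω k m} {x : Fin m → ZMod p}
    {v : EuclideanSpace ℂ (Fin (k + m) → ZMod p)} :
    v ∈ Q.space x ↔ ∀ i, XZLin ω (Q.g i) v = (Q.lam i * chr ω (x i)) • v := by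
  simp only [space, mem_jointEigenspace, ← (WithLp.ofLp_injective 2).eq_iff]
  rfl

theorem code_eq_space_zero (Q : StabilizerCode p ω k m) : Q.code = Q.space 0 := by
  simp [code, space]

theorem exists_mem_code_ne_zero (Q : StabilizerCode p ω k m) :
    ∃ v, v ≠ 0 ∧ ∀ i, XZLin ω (Q.g i) v = Q.lam i • v := by
  obtain ⟨v, hv, h0⟩ := Submodule.exists_mem_ne_zero_of_ne_bot Q.ne_bot
  refine ⟨v, h0, fun i => WithLp.ofLp_injective 2 ?_⟩
  exact mem_jointEigenspace.mp hv i

theorem lam_ne_zero (hω : IsPrimitiveRoot ω p) (Q : StabilizerCode p ω k m) (i : Fin m) :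
    Q.lam i ≠ 0 := by
  obtain ⟨v, h0, hv⟩ := Q.exists_mem_code_ne_zero
  rw [← norm_ne_zero_iff, norm_eigenvalue hω h0 (hv i)]
  exact one_ne_zero

theorem space_isOrtho (hω : IsPrimitiveRoot ω p) (Q : StabilizerCode p ω k m)
    {x y : Fin m → ZMod p} (hxy : x ≠ y) : Q.space x ⟂ Q.space y := by
  rw [Submodule.isOrtho_iff_inner_eq]
  intro v hv w hw
  obtain ⟨i, hi⟩ := Function.ne_iff.mp hxy
  refine inner_eq_zero_of_eigenvalue_ne hω ?_ (mem_space.mp hv i) (mem_space.mp hw i)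
  exact fun h => hi (chr_injective hω (mul_left_cancel₀ (Q.lam_ne_zero hω i) h))

/-- The syndrome of an error. -/
def syndrome (Q : StabilizerCode p ω k m) (u : Fin (k + m) → ZMod p × ZMod p) :
    Fin m → ZMod p := fun i => sympl (Q.g i) u

theorem XZLin_comm (hω : IsPrimitiveRoot ω p) (u t : Fin n → ZMod p × ZMod p)
    (v : EuclideanSpace ℂ (Fin n → ZMod p)) :
    XZLin ω u (XZLin ω t v) = chr ω (sympl u t) • XZLin ω t (XZLin ω u v) := by
  apply WithLp.ofLp_injective 2
  rw [WithLp.ofLp_smul]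
  simp only [ofLp_XZLin, Matrix.mulVec_mulVec]
  rw [XZ_commutation hω u t, Matrix.smul_mulVec]

/-- Commuting `XZ ω u` past the stabilizer generators multiplies their eigenvalues by the characters
of the syndrome of `u`. -/
theorem XZLin_mem_space (hω : IsPrimitiveRoot ω p) (Q : StabilizerCode p ω k m)
    {x : Fin m → ZMod p} (u : Fin (k + m) → ZMod p × ZMod p)
    {v : EuclideanSpace ℂ (Fin (k + m) → ZMod p)} (hv : v ∈ Q.space x) :
    XZLin ω u v ∈ Q.space (x + Q.syndrome u) := by
  rw [mem_space] at hv ⊢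
  intro i
  rw [XZLin_comm hω, hv, map_smul, smul_smul, Pi.add_apply, chr_add hω]
  congr 1
  rw [syndrome]
  ring

/-- Commuting diagonalizable operators are simultaneously diagonalizable, and the only possible
eigenvalues are those labelled by some `x`. -/
theorem iSup_space (hω : IsPrimitiveRoot ω p) (Q : StabilizerCode p ω k m) :
    ⨆ x, Q.space x = ⊤ := by
  have hp : p ≠ 0 := (Fact.out : p.Prime).ne_zero
  obtain ⟨v, h0, hv⟩ := Q.exists_mem_code_ne_zero
  have hpow : ∀ i, XZLin ω (Q.g i) ^ p = Q.lam i ^ p • 1 := fun i =>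
    eigenvalue_pow_prime hω h0 (hv i)
  have hss : ∀ i μ, Module.End.maxGenEigenspace (XZLin ω (Q.g i)) μ =
      Module.End.eigenspace (XZLin ω (Q.g i)) μ := by
    intro i μ
    apply Module.End.IsFinitelySemisimple.maxGenEigenspace_eq_eigenspace
    -- Each generator is annihilated by `X ^ p - lam ^ p`, which is separable because `lam` is
    -- non-zero.
    refine (Module.End.isSemisimple_of_squarefree_aeval_eq_zero
      (p := Polynomial.X ^ p - Polynomial.C (Q.lam i ^ p)) ?_ ?_).isFinitelySemisimple
    · exact (Polynomial.separable_X_pow_sub_C _ (by exact_mod_cast hp)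
        (pow_ne_zero _ (Q.lam_ne_zero hω i))).squarefree
    · rw [map_sub, map_pow, Polynomial.aeval_X, Polynomial.aeval_C, hpow,
        Algebra.algebraMap_eq_smul_one, sub_self]
  have htop := Module.End.iSup_iInf_maxGenEigenspace_eq_top_of_iSup_maxGenEigenspace_eq_top_of_commute
    (fun i => XZLin ω (Q.g i)) (fun i j _ => ?_)
    (fun i => Module.End.iSup_maxGenEigenspace_eq_top _)
  swap
  · refine LinearMap.ext fun w => WithLp.ofLp_injective 2 ?_
    simp only [Module.End.mul_apply, ofLp_XZLin, Matrix.mulVec_mulVec]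
    rw [(Q.commute i j).eq]
  rw [eq_top_iff, ← htop]
  refine iSup_le fun χ => ?_
  intro w hw
  by_cases hw0 : w = 0
  · rw [hw0]; exact Submodule.zero_mem _
  simp only [hss, Submodule.mem_iInf, Module.End.mem_eigenspace_iff] at hw
  have hχ : ∀ i, ∃ a : ZMod p, chr ω a = (Q.lam i)⁻¹ * χ i := by
    intro i
    apply chr_surjOn hω
    have h1 := hpow i
    rw [eigenvalue_pow_prime hω hw0 (hw i)] at h1
    have h2 := LinearMap.congr_fun h1 w
    simp only [LinearMap.smul_apply, Module.End.one_apply] at h2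
    rw [mul_pow, smul_left_injective ℂ hw0 h2, inv_pow,
      inv_mul_cancel₀ (pow_ne_zero _ (Q.lam_ne_zero hω i))]
  choose x hx using hχ
  refine Submodule.mem_iSup_of_mem x (mem_space.mpr fun i => ?_)
  rw [hw, hx, mul_inv_cancel_left₀ (Q.lam_ne_zero hω i)]

/-- Errors of suitable syndrome embed each eigenspace in any other, so all `p ^ m` of them have the
same dimension; they decompose a space of dimension `p ^ (k + m)`. -/
theorem finrank_space (hω : IsPrimitiveRoot ω p) (Q : StabilizerCode p ω k m)
    {e : (Fin m → ZMod p) → Fin (k + m) → ZMod p × ZMod p} (he : ∀ s, Q.syndrome (e s) = s)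
    (x : Fin m → ZMod p) : Module.finrank ℂ (Q.space x) = p ^ k := by
  classical
  have hp : 0 < p := (Fact.out : p.Prime).pos
  have hle : ∀ x y, Module.finrank ℂ (Q.space x) ≤ Module.finrank ℂ (Q.space y) := by
    intro x y
    have hmaps : ∀ v ∈ Q.space x, XZLin ω (e (y - x)) v ∈ Q.space y := fun v hv => by
      have := Q.XZLin_mem_space hω (e (y - x)) hv
      rwa [he, add_sub_cancel] at this
    refine LinearMap.finrank_le_finrank_of_injective (f := (XZLin ω (e (y - x))).restrict hmaps) ?_
    exact fun v w h => Subtype.ext (XZLin_injective hω _ (congrArg Subtype.val h))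
  have hint : DirectSum.IsInternal Q.space := by
    rw [(OrthogonalFamily.of_pairwise fun x y h => Q.space_isOrtho hω h).isInternal_iff,
      Q.iSup_space hω, Submodule.top_orthogonal_eq_bot]
  have hcard := Module.finrank_eq_card_basis
    (hint.collectedBasis fun x => Module.finBasis ℂ (Q.space x))
  rw [Fintype.card_sigma, finrank_euclideanSpace] at hcard
  simp only [Fintype.card_fin, Fintype.card_fun, ZMod.card,
    fun y => le_antisymm (hle y x) (hle x y), Finset.sum_const, Finset.card_univ,
    smul_eq_mul, pow_add] at hcard
  exact (Nat.eq_of_mul_eq_mul_right (pow_pos hp m) (by rw [hcard, mul_comm])).symm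

/-- Conjugating the entries of `XZ ω g` gives the Weyl operator of `starVec g`, so the eigenvalue
equations can be conjugated. -/
theorem star_mem_spaceStar (hω : IsPrimitiveRoot ω p) (Q : StabilizerCode p ω k m)
    {x : Fin m → ZMod p} {v : EuclideanSpace ℂ (Fin (k + m) → ZMod p)} (hv : v ∈ Q.space x) :
    WithLp.toLp 2 (star v.ofLp) ∈ Q.spaceStar x := by
  rw [spaceStar, mem_jointEigenspace]
  intro i
  have h := congrArg (fun w => star w.ofLp) (mem_space.mp hv i)
  simp only [ofLp_XZLin, WithLp.ofLp_smul, star_smul] at h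
  rw [XZ_starVec hω]
  have hconj : (XZ ω (Q.g i)).map (starRingEnd ℂ) *ᵥ star v.ofLp =
      star (XZ ω (Q.g i) *ᵥ v.ofLp) := by
    ext y
    simp [Matrix.mulVec, dotProduct]
  change _ *ᵥ star v.ofLp = _ • star v.ofLp
  rw [hconj, h, Complex.star_def, map_mul, ← Complex.inv_eq_conj (norm_chr hω (x i))]
  rfl

/-- The transpose of a Hermitian projection is its entrywise conjugate. This moves Alice's
measurement over to Bob's side of the maximally entangled state. -/
theorem projMatrix_spaceStar_transpose_mulVec (hω : IsPrimitiveRoot ω p)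
    (Q : StabilizerCode p ω k m) {x : Fin m → ZMod p}
    {v : EuclideanSpace ℂ (Fin (k + m) → ZMod p)} (hv : v ∈ Q.space x) :
    (projMatrix (Q.spaceStar x))ᵀ *ᵥ v.ofLp = v.ofLp := by
  have h := projMatrix_mulVec_of_mem (Q.star_mem_spaceStar hω hv)
  have h' := congrArg star h
  rw [Matrix.star_mulVec, (projMatrix_isHermitian _).eq] at h'
  simpa [Matrix.mulVec_transpose] using h'

end StabilizerCode

end Eigenspaces

/-! ### Fidelity of pure states and mixtures -/

section Fidelity

variable {ι κ : Type*} [Fintype ι]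

theorem fidelity_pureState (v f : ι → ℂ) : fidelity v (pureState f) = ‖star v ⬝ᵥ f‖ ^ 2 := by
  have h : star v ⬝ᵥ (pureState f *ᵥ v) = (star v ⬝ᵥ f) * star (star v ⬝ᵥ f) := by
    rw [pureState, Matrix.vecMulVec_mulVec, op_smul_eq_smul, dotProduct_smul, smul_eq_mul,
      mul_comm, Matrix.star_dotProduct f v]
  rw [fidelity, h, Complex.star_def, Complex.mul_conj, Complex.normSq_eq_norm_sq, Complex.ofReal_re]

theorem fidelity_sum (v : ι → ℂ) (s : Finset κ) (σ : κ → Matrix ι ι ℂ) :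
    fidelity v (∑ j ∈ s, σ j) = ∑ j ∈ s, fidelity v (σ j) := by
  simp only [fidelity, Matrix.sum_mulVec, dotProduct_sum, Complex.re_sum]

theorem fidelity_smul (v : ι → ℂ) (c : ℝ) (σ : Matrix ι ι ℂ) :
    fidelity v ((c : ℂ) • σ) = c * fidelity v σ := by
  simp only [fidelity, Matrix.smul_mulVec, dotProduct_smul, smul_eq_mul, Complex.re_ofReal_mul]

theorem mul_pureState_mul_conjTranspose {ι' : Type*} (M : Matrix ι' ι ℂ) (f : ι → ℂ) :
    M * pureState f * Mᴴ = pureState (M *ᵥ f) := by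
  rw [pureState, pureState, Matrix.mul_vecMulVec, Matrix.vecMulVec_mul, Matrix.star_mulVec]

end Fidelity

/-! ### The fidelity of decoding -/

section CodeFidelity

theorem errorProb_nonneg {p : ℕ} {α : ZMod p × ZMod p → ℝ} (hα : ∀ ab, 0 ≤ α ab) {n : ℕ} (u : Fin n → ZMod p × ZMod p) :
    0 ≤ errorProb α u := Finset.prod_nonneg fun _ _ => hα _

variable {p : ℕ} [Fact p.Prime] {α : ZMod p × ZMod p → ℝ}

theorem sum_errorProb (hα_sum : ∑ ab, α ab = 1) (n : ℕ) :
    ∑ u : Fin n → ZMod p × ZMod p, errorProb α u = 1 := by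
  have h := Finset.prod_univ_sum (fun _ : Fin n => (Finset.univ : Finset (ZMod p × ZMod p)))
    fun _ => α
  rw [hα_sum, Finset.prod_const_one, Fintype.piFinset_univ] at h
  exact h.symm

variable {ω : ℂ} {k m : ℕ}

namespace StabilizerCode

/-- The operator `XZ(e(s))⁻¹ XZ(u)`, `s` the syndrome of `u`, that remains after decoding. -/
noncomputable def residual (Q : StabilizerCode p ω k m)
    (e : (Fin m → ZMod p) → Fin (k + m) → ZMod p × ZMod p)
    (u : Fin (k + m) → ZMod p × ZMod p) :
    EuclideanSpace ℂ (Fin (k + m) → ZMod p) →ₗ[ℂ] EuclideanSpace ℂ (Fin (k + m) → ZMod p) :=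
  Matrix.toEuclideanLin ((XZ ω (e (Q.syndrome u)))⁻¹ * XZ ω u)

variable (Q : StabilizerCode p ω k m) (e : (Fin m → ZMod p) → Fin (k + m) → ZMod p × ZMod p)

theorem ofLp_residual (u : Fin (k + m) → ZMod p × ZMod p)
    (v : EuclideanSpace ℂ (Fin (k + m) → ZMod p)) :
    (Q.residual e u v).ofLp = ((XZ ω (e (Q.syndrome u)))⁻¹ * XZ ω u) *ᵥ v.ofLp := rfl

theorem norm_residual (hω : IsPrimitiveRoot ω p) (u : Fin (k + m) → ZMod p × ZMod p)
    (v : EuclideanSpace ℂ (Fin (k + m) → ZMod p)) : ‖Q.residual e u v‖ = ‖v‖ := by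
  have h : XZLin ω (e (Q.syndrome u)) (Q.residual e u v) = XZLin ω u v := by
    apply WithLp.ofLp_injective 2
    rw [ofLp_XZLin, ofLp_XZLin, ofLp_residual, Matrix.mulVec_mulVec, XZ_inv hω, ← mul_assoc,
      XZ_mul_conjTranspose hω, one_mul]
  rw [← norm_XZLin hω (e (Q.syndrome u)), h, norm_XZLin hω]

theorem projMatrix_XZ_mulVec (hω : IsPrimitiveRoot ω p) {x : Fin m → ZMod p}
    (u : Fin (k + m) → ZMod p × ZMod p) {v : EuclideanSpace ℂ (Fin (k + m) → ZMod p)}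
    (hv : v ∈ Q.space x) (y : Fin m → ZMod p) :
    projMatrix (Q.space y) *ᵥ (XZ ω u *ᵥ v.ofLp) =
      if y = x + Q.syndrome u then XZ ω u *ᵥ v.ofLp else 0 := by
  have hm := Q.XZLin_mem_space hω u hv
  rw [← ofLp_XZLin]
  split_ifs with h
  · rw [h, projMatrix_mulVec_of_mem hm]
  · exact projMatrix_mulVec_of_mem_orthogonal
      ((Q.space_isOrtho hω (Ne.symm h)) hm)

/-- A Weyl error sends a code vector into a single syndrome space, so each error `u` has one certain
outcome and leaves a pure state. -/
theorem fidelity_decode (hω : IsPrimitiveRoot ω p)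
    {φ : EuclideanSpace ℂ (Fin (k + m) → ZMod p)} (hφ : φ ∈ Q.space 0) :
    fidelity φ.ofLp (Q.decode e (pauliChannel ω α (pureState φ.ofLp))) =
      ∑ u, errorProb α u * ‖inner ℂ φ (Q.residual e u φ)‖ ^ 2 := by
  simp only [decode, pauliChannel, Finset.mul_sum, Finset.sum_mul, Matrix.mul_smul,
    Matrix.smul_mul, mul_pureState_mul_conjTranspose, fidelity_sum, fidelity_smul,
    fidelity_pureState]
  rw [Finset.sum_comm]
  refine Finset.sum_congr rfl fun u _ => ?_
  simp only [← Matrix.mulVec_mulVec, Q.projMatrix_XZ_mulVec hω u hφ, zero_add]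
  rw [Finset.sum_eq_single (Q.syndrome u)]
  · rw [if_pos rfl, inner_eq_dotProduct_star, ofLp_residual, ← Matrix.mulVec_mulVec]
  · intro s _ hs
    simp [if_neg hs]
  · simp

end StabilizerCode

end CodeFidelity

/-! ### Bell-diagonal states as vectorized operators; partial trace -/

section States

variable {p : ℕ} [Fact p.Prime] {ω : ℂ} {k m n : ℕ}

theorem bell_apply (ab : ZMod p × ZMod p) (q : ZMod p × ZMod p) :
    bell ω ab q = ((1 / √(p : ℝ) : ℝ) : ℂ) * weyl ω ab q.2 q.1 := by
  rw [bell, Matrix.mulVec, dotProduct, Fintype.sum_prod_type]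
  simp only [Matrix.kroneckerMap_apply, Matrix.one_apply, ite_mul, one_mul, zero_mul]
  simp [mul_comm]

theorem prod_bell (u : Fin n → ZMod p × ZMod p) (q : (Fin n → ZMod p) × (Fin n → ZMod p)) :
    ∏ i, bell ω (u i) (q.1 i, q.2 i) = ((1 / √(p : ℝ) : ℝ) : ℂ) ^ n * XZ ω u q.2 q.1 := by
  simp only [bell_apply, Finset.prod_mul_distrib, Finset.prod_const, Finset.card_univ,
    Fintype.card_fin]
  rfl

theorem bellPower_apply (hω : IsPrimitiveRoot ω p)
    (q : (Fin k → ZMod p) × (Fin k → ZMod p)) :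
    bellPower p ω k q = if q.1 = q.2 then ((1 / √(p : ℝ) : ℝ) : ℂ) ^ k else 0 := by
  have h := prod_bell (ω := ω) (0 : Fin k → ZMod p × ZMod p) q
  rw [XZ_zero hω, Matrix.one_apply, mul_ite, mul_one, mul_zero] at h
  simp only [eq_comm (a := q.1)]
  exact h

theorem statePower_bellDiagonal (α : ZMod p × ZMod p → ℝ) :
    statePower (bellDiagonal ω α) n = ∑ u : Fin n → ZMod p × ZMod p, (errorProb α u : ℂ) •
      pureState (((1 / √(p : ℝ) : ℝ) : ℂ) ^ n • (XZ ω u).vec) := by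
  ext q q'
  have hb : ∀ u : Fin n → ZMod p × ZMod p,
      ((1 / √(p : ℝ) : ℝ) : ℂ) ^ n • (XZ ω u).vec = fun q => ∏ i, bell ω (u i) (q.1 i, q.2 i) :=
    fun u => funext fun q => (prod_bell u q).symm
  simp only [hb]
  simp only [statePower, Matrix.of_apply, bellDiagonal, Matrix.sum_apply, Matrix.smul_apply,
    pureState, Matrix.vecMulVec_apply, smul_eq_mul, Pi.star_apply]
  rw [Finset.prod_univ_sum, Fintype.piFinset_univ]
  refine Finset.sum_congr rfl fun u _ => ?_
  rw [Finset.prod_mul_distrib, Finset.prod_mul_distrib, errorProb, Complex.ofReal_prod, star_prod]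

/-- The partial trace is a sum of pure states over the values of the discarded particles, each of
non-negative fidelity. Only the term with all discarded particles in state 0 is kept, which is where
the chosen ancilla puts the code. -/
theorem le_fidelity_discardLast_pureState (hω : IsPrimitiveRoot ω p)
    (f : (Fin (k + m) → ZMod p) × (Fin (k + m) → ZMod p) → ℂ) :
    ((1 / √(p : ℝ)) ^ k * ‖∑ i : Fin k → ZMod p,
      f (Fin.append i (0 : Fin m → ZMod p), Fin.append i 0)‖) ^ 2 ≤
    fidelity (bellPower p ω k) (discardLast (pureState f)) := by
  have hd : discardLast (pureState f) = ∑ z : Fin m → ZMod p, ∑ w : Fin m → ZMod p,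
      pureState fun q : (Fin k → ZMod p) × (Fin k → ZMod p) =>
        f (Fin.append q.1 z, Fin.append q.2 w) := by
    ext q q'
    simp [discardLast, pureState, Matrix.sum_apply, Matrix.vecMulVec_apply]
  rw [hd]
  simp only [fidelity_sum, fidelity_pureState]
  refine le_trans (le_of_eq ?_) ((Finset.single_le_sum (fun _ _ => sq_nonneg _)
    (Finset.mem_univ (0 : Fin m → ZMod p))).trans (Finset.single_le_sum
      (fun _ _ => Finset.sum_nonneg fun _ _ => sq_nonneg _)
      (Finset.mem_univ (0 : Fin m → ZMod p))))
  congr 1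
  rw [← Complex.norm_of_nonneg (r := (1 / √(p : ℝ)) ^ k) (by positivity), ← norm_mul,
    dotProduct, Fintype.sum_prod_type, Finset.mul_sum]
  congr 1
  refine Finset.sum_congr rfl fun i _ => ?_
  rw [Finset.sum_eq_single i]
  · simp [bellPower_apply hω]
  · intro j _ hj
    simp [bellPower_apply hω, hj.symm]
  · simp

theorem discardLast_sum {κ : Type*} (s : Finset κ)
    (τ : κ → Matrix ((Fin (k + m) → ZMod p) × (Fin (k + m) → ZMod p))
      ((Fin (k + m) → ZMod p) × (Fin (k + m) → ZMod p)) ℂ) :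
    discardLast (∑ j ∈ s, τ j) = ∑ j ∈ s, discardLast (τ j) := by
  ext q q'
  simp only [discardLast, Matrix.of_apply, Matrix.sum_apply]
  rw [Finset.sum_comm]
  simp only [Finset.sum_comm (s := s)]
  rw [Finset.sum_comm]

theorem discardLast_smul (c : ℂ)
    (τ : Matrix ((Fin (k + m) → ZMod p) × (Fin (k + m) → ZMod p))
      ((Fin (k + m) → ZMod p) × (Fin (k + m) → ZMod p)) ℂ) :
    discardLast (c • τ) = c • discardLast τ := by
  ext q q'
  simp [discardLast, Finset.mul_sum]

/-- This is why Alice uses the conjugate encoder: moved to the other side, its inverse becomes `U`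
itself, so that the matrix between the two encoders is conjugated by `U`. -/
theorem inv_map_star_transpose {ι : Type*} [Fintype ι] [DecidableEq ι] {U : Matrix ι ι ℂ}
    (hU : U ∈ Matrix.unitaryGroup ι ℂ) : ((U.map (starRingEnd ℂ))⁻¹)ᵀ = U := by
  rw [Matrix.transpose_nonsing_inv]
  exact Matrix.inv_eq_left_inv (Matrix.mem_unitaryGroup_iff.mp hU)

theorem conjTranspose_mul_mul_apply {ι κ : Type*} [Fintype ι] (A : Matrix ι κ ℂ)
    (B : Matrix ι ι ℂ) (x : κ) : (Aᴴ * (B * A)) x x = star (A.col x) ⬝ᵥ (B *ᵥ A.col x) := rfl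

namespace Protocol

variable {α : ZMod p × ZMod p → ℝ}

theorem kraus_mulVec_vec (P : Protocol p ω α k m) (a b : Fin m → ZMod p)
    (Y : Matrix (Fin (k + m) → ZMod p) (Fin (k + m) → ZMod p) ℂ) :
    P.kraus a b *ᵥ Y.vec = ((P.enc a)ᴴ * (((XZ ω (P.e (b - a)))⁻¹ * (projMatrix (P.Q.space b) *
      (Y * (projMatrix (P.Q.spaceStar a))ᵀ))) * P.enc a)).vec := by
  have hinv : (P.enc a)⁻¹ = (P.enc a)ᴴ :=
    Matrix.inv_eq_left_inv (Matrix.mem_unitaryGroup_iff'.mp (P.enc_unitary a))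
  rw [kraus, ← Matrix.mulVec_mulVec, ← Matrix.mulVec_mulVec, Matrix.kronecker_mulVec_vec,
    Matrix.kronecker_mulVec_vec, Matrix.kronecker_mulVec_vec,
    inv_map_star_transpose (P.enc_unitary a), hinv, Matrix.transpose_one, Matrix.mul_one]
  simp only [Matrix.mul_assoc]

end Protocol

end States

/-! ### Converting a code into a protocol -/

section Conversion

variable {p : ℕ} [Fact p.Prime] {ω : ℂ} {k m : ℕ}

theorem ketTensor_single (i : Fin k → ZMod p) :
    ketTensor i (EuclideanSpace.single (0 : Fin m → ZMod p) (1 : ℂ)).ofLp =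
      Pi.single (Fin.append i 0) 1 := by
  ext x
  simp only [ketTensor, PiLp.single_apply, Pi.single_apply]
  rw [← ite_and]
  refine if_congr ⟨fun h => ?_, fun h => ?_⟩ rfl rfl
  · rw [← h.1, ← h.2, Fin.append_castAdd_natAdd]
  · subst h
    simp only [Fin.append_left, Fin.append_right, true_and]

namespace StabilizerCode

theorem map_XZLin_space (hω : IsPrimitiveRoot ω p) (Q : StabilizerCode p ω k m)
    {e : (Fin m → ZMod p) → Fin (k + m) → ZMod p × ZMod p} (he : ∀ s, Q.syndrome (e s) = s)
    (a : Fin m → ZMod p) : (Q.space 0).map (XZLin ω (e a)) = Q.space a := by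
  refine Submodule.eq_of_le_of_finrank_eq (Submodule.map_le_iff_le_comap.mpr fun v hv => ?_) ?_
  · have := Q.XZLin_mem_space hω (e a) hv
    rwa [he, zero_add] at this
  · rw [← (Submodule.equivMapOfInjective _ (XZLin_injective hω (e a)) _).finrank_eq,
      Q.finrank_space hω he, Q.finrank_space hω he]

/-- A unitary operator that sends the vectors `|i⟩ ⊗ |0⟩` to an orthonormal basis of the code. -/
theorem exists_encoder (hω : IsPrimitiveRoot ω p) (Q : StabilizerCode p ω k m)
    {e : (Fin m → ZMod p) → Fin (k + m) → ZMod p × ZMod p} (he : ∀ s, Q.syndrome (e s) = s) :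
    ∃ (U : Matrix (Fin (k + m) → ZMod p) (Fin (k + m) → ZMod p) ℂ)
      (φ : (Fin k → ZMod p) → EuclideanSpace ℂ (Fin (k + m) → ZMod p)),
      U ∈ Matrix.unitaryGroup (Fin (k + m) → ZMod p) ℂ ∧ Orthonormal ℂ φ ∧
      Submodule.span ℂ (Set.range φ) = Q.space 0 ∧
      ∀ i, U.col (Fin.append i 0) = (φ i).ofLp := by
  classical
  have hcard : Fintype.card (Fin (Module.finrank ℂ (Q.space 0))) =
      Fintype.card (Fin k → ZMod p) := by
    simp [Q.finrank_space hω he, ZMod.card]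
  let b₀ := (stdOrthonormalBasis ℂ (Q.space 0)).reindex (Fintype.equivOfCardEq hcard)
  have hφ : Orthonormal ℂ fun i => (b₀ i : EuclideanSpace ℂ (Fin (k + m) → ZMod p)) :=
    b₀.orthonormal.comp_linearIsometry (Q.space 0).subtypeₗᵢ
  have hspan : Submodule.span ℂ
      (Set.range fun i => (b₀ i : EuclideanSpace ℂ (Fin (k + m) → ZMod p))) = Q.space 0 := by
    have h := congrArg (Submodule.map (Q.space 0).subtype) b₀.toBasis.span_eq
    rw [Submodule.map_span, ← Set.range_comp, Submodule.map_top, Submodule.range_subtype] at h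
    simpa [Function.comp_def] using h
  let left : (Fin (k + m) → ZMod p) → Fin k → ZMod p := fun x j => x (Fin.castAdd m j)
  have hleft : ∀ (i : Fin k → ZMod p), left (Fin.append i (0 : Fin m → ZMod p)) = i :=
    fun i => funext fun j => Fin.append_left _ _ _
  -- The code basis is placed at the indices ending in 0 and then extended to an orthonormal basis
  -- of the whole space, whose vectors are the columns of the encoder.
  let s : Set (Fin (k + m) → ZMod p) := Set.range fun i => Fin.append i 0
  have hs : Orthonormal ℂ
      (s.domRestrict fun x => (b₀ (left x) : EuclideanSpace ℂ (Fin (k + m) → ZMod p))) := by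
    refine hφ.comp (fun x : s => left x) ?_
    rintro ⟨_, i, rfl⟩ ⟨_, j, rfl⟩ h
    simp only [hleft] at h
    rw [h]
  obtain ⟨b, hb⟩ := Orthonormal.exists_orthonormalBasis_extension_of_card_eq
    (finrank_euclideanSpace (𝕜 := ℂ)) hs
  refine ⟨Matrix.of fun x y => (b y).ofLp x, fun i => b₀ i, ?_, hφ, hspan, fun i => ?_⟩
  · rw [Matrix.mem_unitaryGroup_iff']
    ext x y
    have := orthonormal_iff_ite.mp b.orthonormal x y
    rw [inner_eq_dotProduct_star] at this
    rw [Matrix.one_apply, ← this]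
    rfl
  · have := hb _ ⟨i, rfl⟩
    simp only [hleft] at this
    exact congrArg WithLp.ofLp this

/-- The extracted state has at least the entanglement fidelity of the decoded channel. -/
theorem exists_protocol (hω : IsPrimitiveRoot ω p) {α : ZMod p × ZMod p → ℝ}
    (hα : ∀ ab, 0 ≤ α ab) (Q : StabilizerCode p ω k m)
    {e : (Fin m → ZMod p) → Fin (k + m) → ZMod p × ZMod p} (he : Q.IsMostLikely α e) :
    ∃ (P : Protocol p ω α k m) (φ : (Fin k → ZMod p) → EuclideanSpace ℂ (Fin (k + m) → ZMod p)),
      Orthonormal ℂ φ ∧ (∀ i, φ i ∈ Q.space 0) ∧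
      (∑ u, errorProb α u * ‖∑ i, inner ℂ (φ i) (Q.residual e u (φ i))‖ ^ 2) / ((p : ℝ) ^ k) ^ 2 ≤
        fidelity (bellPower p ω k) (P.output (statePower (bellDiagonal ω α) (k + m))) := by
  have hp : (0 : ℝ) < p := by exact_mod_cast (Fact.out : p.Prime).pos
  have hsyn : ∀ s, Q.syndrome (e s) = s := fun s => funext fun i => (he s).1 i
  obtain ⟨U, φ, hU, hφ, hspan, hcol⟩ := Q.exists_encoder hω hsyn
  have hmem : ∀ i, φ i ∈ Q.space 0 := fun i => hspan ▸ Submodule.subset_span ⟨i, rfl⟩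
  have hcol' : ∀ a i, (XZ ω (e a) * U).col (Fin.append i 0) = (XZLin ω (e a) (φ i)).ofLp := by
    intro a i
    rw [ofLp_XZLin, ← hcol]
    rfl
  let P : Protocol p ω α k m :=
    { Q := Q
      e := e
      mostLikely := he
      anc := EuclideanSpace.single 0 1
      norm_anc := by simp
      -- All encoders are translates of one encoder of the code itself, so the residual operators
      -- for different `a` can be compared.
      enc := fun a => XZ ω (e a) * U
      enc_unitary := fun a => mul_mem
        (Matrix.mem_unitaryGroup_iff.mpr (XZ_mul_conjTranspose hω _)) hU
      enc_span := fun a => by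
        simp only [ketTensor_single, Matrix.mulVec_single_one, hcol']
        rw [← Q.map_XZLin_space hω hsyn a, ← hspan, Submodule.map_span, ← Set.range_comp]
        rfl }
  refine ⟨P, φ, hφ, hmem, ?_⟩
  have hentry : ∀ u a i, ((P.enc a)ᴴ * (((XZ ω (e (a + Q.syndrome u - a)))⁻¹ *
      (projMatrix (Q.space (a + Q.syndrome u)) * (XZ ω u * (projMatrix (Q.spaceStar a))ᵀ))) *
        P.enc a)) (Fin.append i 0) (Fin.append i 0) =
      chr ω (sympl u (e a) - sympl (e (Q.syndrome u)) (e a)) *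
        inner ℂ (φ i) (Q.residual e u (φ i)) := by
    intro u a i
    have hψ : XZLin ω (e a) (φ i) ∈ Q.space a := by
      have := Q.XZLin_mem_space hω (e a) (hmem i)
      rwa [hsyn, zero_add] at this
    rw [conjTranspose_mul_mul_apply, show P.enc a = XZ ω (e a) * U from rfl, hcol',
      add_sub_cancel_left]
    simp only [← Matrix.mulVec_mulVec]
    rw [Q.projMatrix_spaceStar_transpose_mulVec hω hψ, Q.projMatrix_XZ_mulVec hω u hψ, if_pos rfl]
    have hres : XZ ω u *ᵥ (φ i).ofLp =
        (XZLin ω (e (Q.syndrome u)) (Q.residual e u (φ i))).ofLp := by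
      rw [ofLp_XZLin, ofLp_residual, Matrix.mulVec_mulVec, XZ_inv hω, ← mul_assoc,
        XZ_mul_conjTranspose hω, one_mul]
    -- Both the error and its guess are commuted past `XZ ω (e a)`. The resulting phase depends on
    -- `u` and `a` but not on `i`, so it leaves the sum over `i` coherent.
    have hcomm : XZ ω u *ᵥ (XZLin ω (e a) (φ i)).ofLp =
        chr ω (sympl u (e a) - sympl (e (Q.syndrome u)) (e a)) • XZ ω (e (Q.syndrome u)) *ᵥ
          (XZ ω (e a) *ᵥ (Q.residual e u (φ i)).ofLp) := by
      rw [ofLp_XZLin, Matrix.mulVec_mulVec, XZ_commutation hω u, Matrix.smul_mulVec,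
        ← Matrix.mulVec_mulVec, hres, ofLp_XZLin, Matrix.mulVec_mulVec,
        Matrix.mulVec_mulVec, XZ_commutation hω (e (Q.syndrome u)) (e a), Matrix.smul_mulVec,
        smul_smul, ← chr_add hω, sub_add_cancel]
    rw [hcomm, Matrix.mulVec_smul, Matrix.mulVec_mulVec, XZ_inv hω, XZ_conjTranspose_mul hω,
      Matrix.one_mulVec, dotProduct_smul, ← ofLp_XZLin, ← inner_eq_dotProduct_star,
      inner_XZLin hω, smul_eq_mul]
  set c : ℝ := 1 / √(p : ℝ) with hc
  have hc2 : c ^ 2 * p = 1 := by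
    rw [hc, div_pow, Real.sq_sqrt hp.le]
    field_simp
  have hterm : ∀ (a b : Fin m → ZMod p) (u : Fin (k + m) → ZMod p × ZMod p),
      fidelity (bellPower p ω k) (discardLast (pureState
        (P.kraus a b *ᵥ ((c : ℂ) ^ (k + m) • (XZ ω u).vec)))) ≥
      (if b = a + Q.syndrome u then c ^ (2 * k) * c ^ (2 * (k + m)) *
        ‖∑ i, inner ℂ (φ i) (Q.residual e u (φ i))‖ ^ 2 else 0) := by
    intro a b u
    -- For `b` other than `a + Q.syndrome u`, non-negativity is all that is needed.
    refine le_trans ?_ (le_fidelity_discardLast_pureState hω _)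
    split_ifs with hb
    · subst hb
      rw [Matrix.mulVec_smul, P.kraus_mulVec_vec]
      simp only [Pi.smul_apply, Matrix.vec]
      have h := fun i => hentry u a i
      rw [show P.Q = Q from rfl, show P.e = e from rfl]
      simp only [h, smul_eq_mul]
      rw [← Finset.mul_sum, ← Finset.mul_sum, norm_mul, norm_mul, norm_chr hω, norm_pow,
        Complex.norm_of_nonneg (by positivity)]
      exact le_of_eq (by ring)
    · positivity
  have hout : P.output (statePower (bellDiagonal ω α) (k + m)) =
      ∑ a, ∑ b, ∑ u, (errorProb α u : ℂ) • discardLast (pureState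
        (P.kraus a b *ᵥ ((c : ℂ) ^ (k + m) • (XZ ω u).vec))) := by
    rw [Protocol.output, statePower_bellDiagonal]
    simp only [Finset.mul_sum, Finset.sum_mul, Matrix.mul_smul, Matrix.smul_mul,
      mul_pureState_mul_conjTranspose, discardLast_sum, discardLast_smul]
    rfl
  rw [hout]
  simp only [fidelity_sum, fidelity_smul]
  calc _ = ∑ u, ∑ a : Fin m → ZMod p, ∑ b : Fin m → ZMod p, errorProb α u *
        (if b = a + Q.syndrome u then c ^ (2 * k) * c ^ (2 * (k + m)) *
          ‖∑ i, inner ℂ (φ i) (Q.residual e u (φ i))‖ ^ 2 else 0) := by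
        rw [Finset.sum_div]
        refine Finset.sum_congr rfl fun u _ => ?_
        simp only [mul_ite, mul_zero, Finset.sum_ite_eq', Finset.mem_univ, if_true,
          Finset.sum_const, Finset.card_univ, Fintype.card_fun, ZMod.card, Fintype.card_fin,
          nsmul_eq_mul, Nat.cast_pow]
        -- The `p ^ m` outcomes `a` contribute equally. The powers of `c` come from normalizing the
        -- `k` target pairs and the `k + m` initial pairs, and what remains is the squared dimension
        -- of the code.
        have hpow : (p : ℝ) ^ m * (c ^ (2 * k) * c ^ (2 * (k + m))) * ((p : ℝ) ^ k) ^ 2 = 1 := by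
          have : (c ^ 2 * p) ^ (k + (k + m)) = 1 := by rw [hc2, one_pow]
          rw [← this]
          ring
        rw [div_eq_iff (by positivity)]
        linear_combination (-errorProb α u *
          ‖∑ i, inner ℂ (φ i) (Q.residual e u (φ i))‖ ^ 2) * hpow
    _ = ∑ a : Fin m → ZMod p, ∑ b : Fin m → ZMod p, ∑ u, errorProb α u *
        (if b = a + Q.syndrome u then c ^ (2 * k) * c ^ (2 * (k + m)) *
          ‖∑ i, inner ℂ (φ i) (Q.residual e u (φ i))‖ ^ 2 else 0) := by
        rw [Finset.sum_comm]
        exact Finset.sum_congr rfl fun a _ => Finset.sum_comm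
    _ ≤ _ := Finset.sum_le_sum fun a _ => Finset.sum_le_sum fun b _ =>
        Finset.sum_le_sum fun u _ =>
          mul_le_mul_of_nonneg_left (hterm a b u) (errorProb_nonneg hα u)

end StabilizerCode

theorem CodeExists.protocolExists (hω : IsPrimitiveRoot ω p) {α : ZMod p × ZMod p → ℝ}
    (hα : ∀ ab, 0 ≤ α ab) (hα_sum : ∑ ab, α ab = 1) {ε : ℝ} (hε : 0 ≤ ε)
    (h : CodeExists p ω α k m ε) : ProtocolExists p ω α k m (4 * ε) := by
  have hp : (0 : ℝ) < p := by exact_mod_cast (Fact.out : p.Prime).pos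
  obtain ⟨Q, e, he, hQ⟩ := h
  obtain ⟨P, φ, hφ, hmem, hP⟩ := Q.exists_protocol hω hα he
  refine ⟨P, le_trans ?_ hP⟩
  rw [le_div_iff₀ (by positivity)]
  have hb := entanglement_fidelity_bound (errorProb_nonneg hα) (sum_errorProb hα_sum (k + m))
    (Q.residual e) (Q.norm_residual e hω) (Q.space 0) hφ hmem hε fun v hv hv1 => by
      rw [← Q.fidelity_decode e hω hv]
      exact hQ v (Q.code_eq_space_zero ▸ hv) hv1
  simpa using hb

end Conversion

/-! ### Comparison of maximal rates -/

/-- Below rate 0 the condition on `k` is vacuous, so only the existence of some good instance for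
each `ε` matters. -/
theorem IsRate.zero_of_isRate {T : ℕ → ℕ → ℝ → Prop} {R : ℝ} (h : IsRate T R) : IsRate T 0 := by
  intro R' hR' ε hε
  obtain ⟨k, m, hk, -, hT⟩ := h (R - 1) (by linarith) ε hε
  refine ⟨k, m, hk, ?_, hT⟩
  exact (mul_nonpos_of_nonneg_of_nonpos (Nat.cast_nonneg _) hR'.le).trans (Nat.cast_nonneg k)

theorem maxRate_nonneg (T : ℕ → ℕ → ℝ → Prop) : 0 ≤ maxRate T := by
  rcases Set.eq_empty_or_nonempty {R | IsRate T R} with h | h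
  · rw [maxRate, h, Real.sSup_empty]
  · exact (isGreatest_maxRate T h).2 (isGreatest_maxRate T h).1.zero_of_isRate

/-- If `S` has no rate, the left side is the default value 0 of `sSup ∅`, and `maxRate_nonneg` is
what makes the comparison hold. -/
theorem maxRate_mono {S T : ℕ → ℕ → ℝ → Prop} (h : ∀ R, IsRate S R → IsRate T R) :
    maxRate S ≤ maxRate T := by
  rcases Set.eq_empty_or_nonempty {R | IsRate S R} with hS | hS
  · rw [maxRate, hS, Real.sSup_empty]
    exact maxRate_nonneg T
  · exact (isGreatest_maxRate T (hS.mono h)).2 (h _ (isGreatest_maxRate S hS).1)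

end StabDistill

theorem mainTheorem1 (p : ℕ) [Fact p.Prime] (ω : ℂ) (hω : IsPrimitiveRoot ω p)
    (α : ZMod p × ZMod p → ℝ) (hα : ∀ ab, 0 ≤ α ab) (hα_sum : ∑ ab, α ab = 1) :
    (∀ R : ℝ, StabDistill.IsRate (StabDistill.CodeExists p ω α) R →
      StabDistill.IsRate (StabDistill.ProtocolExists p ω α) R) ∧
    StabDistill.achievableRate p ω α ≤ StabDistill.distillableEntanglement p ω α := by
  have h : ∀ R : ℝ, StabDistill.IsRate (StabDistill.CodeExists p ω α) R →
      StabDistill.IsRate (StabDistill.ProtocolExists p ω α) R := by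
    intro R hR R' hR' ε hε
    obtain ⟨k, m, hk, hkm, hT⟩ := hR R' hR' (ε / 4) (by positivity)
    refine ⟨k, m, hk, hkm, ?_⟩
    have := hT.protocolExists hω hα hα_sum (by positivity)
    rwa [mul_div_cancel₀ ε (by norm_num : (4 : ℝ) ≠ 0)] at this
  exact ⟨h, StabDistill.maxRate_mono h⟩
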